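/- For a convex body $K\subset\mathbb R^n$ (a compact convex set with non-empty interior), say that a direction $u\in\mathbb S^{n-1}$ illuminates $K$ at a boundary point $b$ if the open ray $\{b+\lambda u:\lambda>0\}$ meets the interior of $K$. Let the illumination number ${\rm i}(K)$ be the minimum number of directions such that each boundary point of $K$ is illuminated by at least one of them, and let $N(K,L)$ denote the minimum number of translates of $L$ that cover $K$. Let $\mathbf B^n$ be the closed Euclidean unit ball of $\mathbb R^n$ centered at the origin $o$. Theorem. Let $1<D<1.116$. Then there is an $n_0$, depending on $D$, such that for every $n\ge n_0$ there is a convex body $K\subset\mathbb R^n$ with $K=-K$ (that is, $K$ is $o$-symmetric) such that $$\frac1D\mathbf B^n\subset K\subset\mathbf B^n ,$$ and whose illumination number is finite and satisfies $${\rm i}(K)=N(K,{\rm int}\,K)\ \ge\ 0.05\,D^n .$$ -/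

import Mathlib

open scoped Pointwise

/-- `K` is a convex body: a compact convex set with nonempty interior. -/
structure IsConvexBody {E : Type*} [NormedAddCommGroup E] [NormedSpace ℝ E] (K : Set E) :
    Prop where
  isCompact : IsCompact K
  convex : Convex ℝ K
  interior_nonempty : (interior K).Nonempty

/-- The translative covering number `N(K, L)`: the minimum number of translates of `L` that
cover `K` (it is `⊤` if finitely many do not suffice). -/
noncomputable def coveringNumber {E : Type*} [NormedAddCommGroup E] (K L : Set E) : ℕ∞ :=
  ⨅ (V : Set E) (_ : K ⊆ ⋃ v ∈ V, (v +ᵥ L)), V.encard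

/-- The direction `u` illuminates `K` at the point `b`: the open ray from `b` in direction `u`
meets the interior of `K`. -/
def IlluminatesAt {E : Type*} [NormedAddCommGroup E] [NormedSpace ℝ E]
    (K : Set E) (u b : E) : Prop :=
  ∃ t : ℝ, 0 < t ∧ b + t • u ∈ interior K

/-- The illumination number `i(K)`: the minimum number of directions (unit vectors) such that
every boundary point of `K` is illuminated by at least one of them
(it is `⊤` if finitely many do not suffice). -/
noncomputable def illuminationNumber {E : Type*} [NormedAddCommGroup E] [NormedSpace ℝ E]
    (K : Set E) : ℕ∞ :=
  ⨅ (U : Set E) (_ : U ⊆ Metric.sphere (0 : E) 1 ∧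
    ∀ b ∈ frontier K, ∃ u ∈ U, IlluminatesAt K u b), U.encard

/-!
The body is a *spiky ball*: the convex hull of the ball of radius `1 / D` and of finitely many
antipodal pairs `±p` of unit vectors. If distinct pairs are well separated, the body lies, at each
tip `p`, in the cone with apex `p` tangent to the inner ball (`spikyBall_subset_cone`), so a
direction `u` illuminates `p` only if `-u` makes with `p` an angle of at most
`α = arcsin (1 / D)` (`IlluminatesAt.le_inner_neg`). An illuminating set of directions therefore
gives a family of caps of radius `α` containing all the tips, and it remains to choose separated
tips that no `m = ⌊0.05 D ^ n⌋` such caps contain (`exists_separated_tips`).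

A cap of radius `α ≥ π / 4` takes up at most the fraction `sin α ^ n = D ^ (-n)` of the sphere,
since the cone over it lies in a ball of radius `sin α` (`capCone_subset_closedBall`). Hence `m`
caps occupy only a small part of the sphere, even after being enlarged so that their centres
belong to a finite net. Averaging over the sphere shows that a further tip can be chosen outside
the neighbourhoods of the earlier ones in such a way that at most half of the remaining `m`-tuples
of net points still have all tips in their caps
(`exists_separated_finset_two_pow_mul_card_le`). The number of steps needed to exhaust the tuples
is `m` times a polynomial in `n`, whereas each tip excludes a fraction of at most
`2 * (4 / 5) ^ n` of the sphere; as `4 / 5 * D < 1`, there is room for all the steps in high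
dimension.

That illumination and covering numbers agree holds for every convex body: if `b ∈ v + int K` is a
boundary point then `-v` illuminates `b`, and conversely, by compactness, all points of `K` can be
moved into `int K` along the illuminating directions by one common distance.
-/

/-! ### Illumination and covering by translates of the interior -/

lemma frontier_nonempty_of_isConvexBody {E : Type*} [NormedAddCommGroup E] [NormedSpace ℝ E]
    [Nontrivial E] {K : Set E} (hK : IsConvexBody K) : (frontier K).Nonempty := by
  refine nonempty_frontier_iff.2 ⟨hK.interior_nonempty.mono interior_subset, ?_⟩
  rintro rfl
  exact NormedSpace.unbounded_univ ℝ E hK.isCompact.isBounded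

/-- If `b ∈ v + int K` is a boundary point of `K`, then `-v` points from `b` into `int K`. -/
lemma illuminationNumber_le_coveringNumber {E : Type*} [NormedAddCommGroup E] [NormedSpace ℝ E]
    {K : Set E} (hK : IsConvexBody K) :
    illuminationNumber K ≤ coveringNumber K (interior K) := by
  refine le_iInf₂ fun V hV => ?_
  refine iInf₂_le_of_le ((fun v => -(‖v‖⁻¹ • v)) '' (V \ {0})) ⟨?_, ?_⟩
    ((Set.encard_image_le _ _).trans (Set.encard_le_encard Set.sdiff_subset))
  · rintro _ ⟨v, ⟨-, hv⟩, rfl⟩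
    simpa using norm_smul_inv_norm (𝕜 := ℝ) (show v ≠ 0 from hv)
  · intro b hb
    have hbK : b ∈ K := hK.isCompact.isClosed.frontier_subset hb
    obtain ⟨v, hvV, x, hx, hxb⟩ := Set.mem_iUnion₂.1 (hV hbK)
    have hxb : v + x = b := hxb
    have hv : v ≠ 0 := by
      rintro rfl
      rw [zero_add] at hxb
      subst hxb
      exact hb.2 hx
    refine ⟨_, ⟨v, ⟨hvV, hv⟩, rfl⟩, ‖v‖, norm_pos_iff.2 hv, ?_⟩
    have : b + ‖v‖ • -(‖v‖⁻¹ • v) = x := by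
      rw [smul_neg, smul_smul, mul_inv_cancel₀ (norm_ne_zero_iff.2 hv), one_smul, ← hxb]
      abel
    rwa [this]

/-- Moving from a point of `K` towards an interior point, every intermediate position is
interior. -/
lemma add_smul_mem_interior_of_le {E : Type*} [NormedAddCommGroup E] [NormedSpace ℝ E]
    {K : Set E} (hK : Convex ℝ K) {x u : E} (hx : x ∈ K) {s t : ℝ} (hs : 0 < s) (hst : s ≤ t)
    (h : x + t • u ∈ interior K) : x + s • u ∈ interior K := by
  have ht : 0 < t := hs.trans_le hst
  have := hK.add_smul_sub_mem_interior hx h (t := s / t) ⟨by positivity, (div_le_one ht).2 hst⟩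
  rwa [add_sub_cancel_left, smul_smul, div_mul_cancel₀ _ ht.ne'] at this

/-- By compactness, the directions of an illuminating set all reach `int K` after one common
small step `t` from every point of `K`, so the translates `-t u + int K` cover `K`. -/
lemma coveringNumber_le_illuminationNumber {E : Type*} [NormedAddCommGroup E] [NormedSpace ℝ E]
    [Nontrivial E] {K : Set E} (hK : IsConvexBody K) :
    coveringNumber K (interior K) ≤ illuminationNumber K := by
  refine le_iInf₂ fun U hU => ?_
  obtain ⟨b₀, hb₀⟩ := frontier_nonempty_of_isConvexBody hK
  obtain ⟨u₀, hu₀, -⟩ := hU.2 b₀ hb₀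
  let O : ℕ → Set E := fun k => ⋃ u ∈ U, (fun x => x + (1 / ((k : ℝ) + 1)) • u) ⁻¹' interior K
  have hO : ∀ k, IsOpen (O k) := fun k => isOpen_biUnion fun u _ =>
    isOpen_interior.preimage (by fun_prop)
  have hcov : K ⊆ ⋃ k, O k := by
    intro x hx
    suffices h : ∃ u ∈ U, IlluminatesAt K u x by
      obtain ⟨u, hu, t, ht, hxt⟩ := h
      obtain ⟨k, hk⟩ := exists_nat_one_div_lt ht
      exact Set.mem_iUnion.2 ⟨k, Set.mem_iUnion₂.2 ⟨u, hu,
        add_smul_mem_interior_of_le hK.convex hx (by positivity) hk.le hxt⟩⟩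
    by_cases hxi : x ∈ interior K
    · refine ⟨u₀, hu₀, ?_⟩
      have hc : Filter.Tendsto (fun t : ℝ => x + t • u₀) (nhdsWithin 0 (Set.Ioi 0)) (nhds x) := by
        have : Continuous fun t : ℝ => x + t • u₀ := by fun_prop
        have h := this.tendsto 0
        rw [zero_smul, add_zero] at h
        exact h.mono_left nhdsWithin_le_nhds
      obtain ⟨t, h1, h2⟩ :=
        ((hc.eventually (isOpen_interior.mem_nhds hxi)).and self_mem_nhdsWithin).exists
      exact ⟨t, h2, h1⟩
    · exact hU.2 x ⟨subset_closure hx, hxi⟩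
  obtain ⟨T, hT⟩ := hK.isCompact.elim_finite_subcover O hO hcov
  have key : ∃ t : ℝ, K ⊆ ⋃ u ∈ U, (fun x => x + t • u) ⁻¹' interior K := by
    refine ⟨1 / (((T.sup id : ℕ) : ℝ) + 1), fun x hx => ?_⟩
    obtain ⟨k, hk, hxk⟩ := Set.mem_iUnion₂.1 (hT hx)
    obtain ⟨u, hu, hxu⟩ := Set.mem_iUnion₂.1 hxk
    refine Set.mem_iUnion₂.2 ⟨u, hu,
      add_smul_mem_interior_of_le hK.convex hx (by positivity) ?_ hxu⟩
    have : (k : ℝ) ≤ ((T.sup id : ℕ) : ℝ) := by exact_mod_cast Finset.le_sup (f := id) hk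
    exact one_div_le_one_div_of_le (by positivity) (by linarith)
  obtain ⟨t, ht⟩ := key
  refine iInf₂_le_of_le ((fun u => -(t • u)) '' U) ?_ (Set.encard_image_le _ _)
  intro x hx
  obtain ⟨u, hu, hxu⟩ := Set.mem_iUnion₂.1 (ht hx)
  refine Set.mem_iUnion₂.2 ⟨_, ⟨u, hu, rfl⟩, x + t • u, hxu, ?_⟩
  simp

lemma coveringNumber_interior_ne_top {E : Type*} [NormedAddCommGroup E] [NormedSpace ℝ E]
    {K : Set E} (hK : IsConvexBody K) : coveringNumber K (interior K) ≠ ⊤ := by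
  obtain ⟨x₀, hx₀⟩ := hK.interior_nonempty
  obtain ⟨T, hT⟩ := hK.isCompact.elim_finite_subcover (fun v : E => v +ᵥ interior K)
    (fun v => isOpen_interior.vadd v)
    (fun x _ => Set.mem_iUnion.2 ⟨x - x₀, x₀, hx₀, by simp⟩)
  refine ne_top_of_le_ne_top ?_ (iInf₂_le (T : Set E) (by simpa using hT))
  simp

/-! ### The spiky ball -/

/-- The spiky ball: the smallest closed convex set containing the ball of radius `r` about the
origin and the points `p` and `-p` for all `p ∈ P`. -/
def spikyBall {E : Type*} [NormedAddCommGroup E] [NormedSpace ℝ E] (P : Set E) (r : ℝ) : Set E :=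
  closedConvexHull ℝ (P ∪ -P ∪ Metric.closedBall (0 : E) r)

section SpikyBall

variable {E : Type*} [NormedAddCommGroup E] [InnerProductSpace ℝ E] {P : Set E} {r : ℝ}

lemma closedBall_subset_spikyBall : Metric.closedBall (0 : E) r ⊆ spikyBall P r :=
  Set.subset_union_right.trans (subset_closedConvexHull (𝕜 := ℝ))

lemma subset_spikyBall : P ⊆ spikyBall P r :=
  (Set.subset_union_left.trans Set.subset_union_left).trans (subset_closedConvexHull (𝕜 := ℝ))

lemma spikyBall_subset_closedBall (hP : ∀ p ∈ P, ‖p‖ = 1) (hr : r ≤ 1) :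
    spikyBall P r ⊆ Metric.closedBall (0 : E) 1 := by
  refine closedConvexHull_min ?_ (convex_closedBall _ _) Metric.isClosed_closedBall
  rintro x ((hx | hx) | hx)
  · simp [hP x hx]
  · simp [← norm_neg x, hP _ hx]
  · exact Metric.closedBall_subset_closedBall hr hx

lemma neg_spikyBall : -spikyBall P r = spikyBall P r := by
  have h : -spikyBall P r ⊆ spikyBall P r := by
    rw [Set.neg_subset]
    refine closedConvexHull_min ?_ (convex_closedConvexHull (𝕜 := ℝ)).neg
      (isClosed_closedConvexHull (𝕜 := ℝ)).neg
    rw [← Set.neg_subset]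
    refine Set.Subset.trans (fun x hx => ?_) (subset_closedConvexHull (𝕜 := ℝ))
    simpa [or_comm] using hx
  exact h.antisymm (by simpa using Set.neg_subset_neg.2 h)

lemma isConvexBody_spikyBall [FiniteDimensional ℝ E] (hP : ∀ p ∈ P, ‖p‖ = 1) (hr₀ : 0 < r)
    (hr : r ≤ 1) : IsConvexBody (spikyBall P r) where
  isCompact := (isCompact_closedBall (0 : E) 1).of_isClosed_subset
    (isClosed_closedConvexHull (𝕜 := ℝ)) (spikyBall_subset_closedBall hP hr)
  convex := convex_closedConvexHull (𝕜 := ℝ)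
  interior_nonempty := ⟨0, interior_mono closedBall_subset_spikyBall
    (Metric.ball_subset_interior_closedBall (Metric.mem_ball_self hr₀))⟩

lemma mem_frontier_spikyBall [Nontrivial E] (hP : ∀ p ∈ P, ‖p‖ = 1) (hr : r ≤ 1) {p : E}
    (hp : p ∈ P) : p ∈ frontier (spikyBall P r) := by
  refine ⟨subset_closure (subset_spikyBall hp), fun h => ?_⟩
  have := interior_mono (spikyBall_subset_closedBall hP hr) h
  rw [interior_closedBall _ one_ne_zero] at this
  simp [hP p hp] at this

/-- If the spikes are far enough apart, the spiky ball lies in the cone with apex at a tip `p`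
that is tangent to the inner ball. -/
lemma spikyBall_subset_cone (hP : ∀ p ∈ P, ‖p‖ = 1) (hr₀ : 0 ≤ r) (hr : r ≤ 1)
    (hsep : ∀ p ∈ P, ∀ q ∈ P, p ≠ q → |inner ℝ p q| ≤ 2 * r ^ 2 - 1) {p : E} (hp : p ∈ P) :
    spikyBall P r ⊆ {x | √(1 - r ^ 2) * ‖x - p‖ ≤ inner ℝ (p - x) p} := by
  set c := √(1 - r ^ 2) with hc
  have hr2 : r ^ 2 ≤ 1 := pow_le_one₀ hr₀ hr
  have hc2 : c ^ 2 = 1 - r ^ 2 := Real.sq_sqrt (by linarith)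
  have hpp : inner ℝ p p = (1 : ℝ) := by rw [real_inner_self_eq_norm_sq, hP p hp, one_pow]
  -- It suffices to compare squares, expanded in terms of `⟪x, p⟫` and `‖x‖`.
  have main : ∀ x : E, inner ℝ x p ≤ (1 : ℝ) →
      (1 - r ^ 2) * (‖x‖ ^ 2 - 2 * inner ℝ x p + 1) ≤ (1 - inner ℝ x p) ^ 2 →
      c * ‖x - p‖ ≤ inner ℝ (p - x) p := by
    intro x h1 h2
    rw [inner_sub_left, hpp]
    refine abs_le_of_sq_le_sq' ?_ (by linarith) |>.2
    rw [mul_pow, hc2, norm_sub_sq_real, hP p hp, one_pow]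
    exact h2
  refine closedConvexHull_min ?_ ?_ (isClosed_le (by fun_prop) (by fun_prop))
  · have tip : ∀ q : E, ‖q‖ = 1 → inner ℝ q p ≤ 2 * r ^ 2 - 1 →
        c * ‖q - p‖ ≤ inner ℝ (p - q) p := fun q hq h =>
      main q (by linarith) (by rw [hq]; nlinarith)
    rintro x ((hx | hx) | hx)
    · by_cases hxp : x = p
      · simp [hxp]
      · exact tip x (hP x hx) ((le_abs_self _).trans (hsep x hx p hp hxp))
    · have hx1 : ‖x‖ = 1 := by rw [← norm_neg]; exact hP _ hx
      by_cases hxp : -x = p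
      · refine tip x hx1 ?_
        have : inner ℝ x p = (-1 : ℝ) := by
          rw [← hxp, inner_neg_right, real_inner_self_eq_norm_sq, hx1, one_pow]
        nlinarith [sq_nonneg r]
      · refine tip x hx1 ((neg_le_abs _).trans' ?_ |>.trans (hsep _ hx p hp hxp))
        rw [inner_neg_left, neg_neg]
    · have hxr : ‖x‖ ≤ r := by simpa using hx
      have h1 : inner ℝ x p ≤ ‖x‖ := by simpa [hP p hp] using real_inner_le_norm x p
      have h2 : ‖x‖ ^ 2 ≤ r ^ 2 := by gcongr
      refine main x (by linarith) ?_
      nlinarith [sq_nonneg (inner ℝ x p - r ^ 2),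
        mul_le_mul_of_nonneg_left h2 (sub_nonneg.2 hr2)]
  · have hf : ConvexOn ℝ Set.univ fun x : E => c * ‖x - p‖ - inner ℝ (p - x) p := by
      refine ⟨convex_univ, fun x _ y _ a b ha hb hab => ?_⟩
      have e : a • x + b • y - p = a • (x - p) + b • (y - p) := by
        rw [smul_sub, smul_sub, sub_add_sub_comm, ← add_smul, hab, one_smul]
      have h1 : ‖a • x + b • y - p‖ ≤ a * ‖x - p‖ + b * ‖y - p‖ := by
        rw [e]
        refine (norm_add_le _ _).trans_eq ?_
        rw [norm_smul, norm_smul, Real.norm_of_nonneg ha, Real.norm_of_nonneg hb]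
      have h2 := mul_le_mul_of_nonneg_left h1 (Real.sqrt_nonneg (1 - r ^ 2))
      rw [← hc] at h2
      simp only [smul_eq_mul, inner_sub_left, inner_add_left, real_inner_smul_left, hpp]
      obtain rfl : b = 1 - a := by linarith
      nlinarith
    simpa [sub_nonpos] using hf.convex_le 0

/-- A direction illuminates a well separated tip only if its opposite makes a small angle with
the tip. -/
lemma IlluminatesAt.le_inner_neg (hP : ∀ p ∈ P, ‖p‖ = 1) (hr₀ : 0 ≤ r) (hr : r ≤ 1)
    (hsep : ∀ p ∈ P, ∀ q ∈ P, p ≠ q → |inner ℝ p q| ≤ 2 * r ^ 2 - 1) {p u : E} (hp : p ∈ P)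
    (hu : ‖u‖ = 1) (h : IlluminatesAt (spikyBall P r) u p) :
    √(1 - r ^ 2) ≤ inner ℝ p (-u) := by
  obtain ⟨t, ht, hx⟩ := h
  have := spikyBall_subset_cone hP hr₀ hr hsep hp (interior_subset hx)
  simp only [Set.mem_ofPred_eq, add_sub_cancel_left, norm_smul, hu, Real.norm_of_nonneg ht.le,
    sub_add_cancel_left, inner_neg_left, real_inner_smul_left, mul_one] at this
  rw [inner_neg_right, real_inner_comm]
  nlinarith

end SpikyBall

/-! ### Caps and their volume -/

/-- The cone of vectors whose inner product with `w` is at least `a` times their norm,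
intersected with the open unit ball. For a unit vector `w` and `0 ≤ a` this is the cone over a
spherical cap centred at `w`. -/
def capCone {E : Type*} [NormedAddCommGroup E] [InnerProductSpace ℝ E] (w : E) (a : ℝ) : Set E :=
  {x | a * ‖x‖ ≤ inner ℝ x w} ∩ Metric.ball 0 1

lemma measurableSet_capCone {E : Type*} [NormedAddCommGroup E] [InnerProductSpace ℝ E]
    [MeasurableSpace E] [BorelSpace E] (w : E) (a : ℝ) : MeasurableSet (capCone w a) :=
  (isClosed_le (by fun_prop) (by fun_prop)).measurableSet.inter measurableSet_ball

/-- The cone over a cap of angular radius `arccos c ≥ π / 4`, slightly enlarged, lies in a ball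
of radius `ρ ≈ √(1 - c²)`. -/
lemma capCone_subset_closedBall {E : Type*} [NormedAddCommGroup E] [InnerProductSpace ℝ E]
    {w : E} {c δ ρ : ℝ} (hc : 0 ≤ c) (hc' : 2 * c ^ 2 ≤ 1) (hδ : 0 ≤ δ) (hδ' : δ ≤ 1)
    (hρ : 0 ≤ ρ) (hw : ‖w‖ ≤ 1 + δ) (hcρ : 1 - c ^ 2 + 5 * δ ≤ ρ ^ 2) :
    capCone w (c - δ) ⊆ Metric.closedBall (c • w) ρ := by
  rintro x ⟨hx, hx1⟩
  rw [mem_closedBall_iff_norm]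
  refine abs_le_of_sq_le_sq' ?_ hρ |>.2
  have hx1 : ‖x‖ ≤ 1 := (mem_ball_zero_iff.1 hx1).le
  have hx : (c - δ) * ‖x‖ ≤ inner ℝ x w := hx
  have h0 := norm_nonneg x
  have hc1 : c ≤ 1 := by nlinarith
  rw [norm_sub_sq_real, real_inner_smul_right, norm_smul, Real.norm_of_nonneg hc, mul_pow]
  have h1 : ‖w‖ ^ 2 ≤ (1 + δ) ^ 2 := by gcongr
  have h2 : c ^ 2 * ‖w‖ ^ 2 ≤ c ^ 2 * (1 + δ) ^ 2 := by gcongr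
  have h3 : ‖x‖ ^ 2 ≤ ‖x‖ := by nlinarith
  have h4 : c * ((c - δ) * ‖x‖) ≤ c * inner ℝ x w := by gcongr
  have h5 : ‖x‖ * (1 - 2 * c ^ 2 + 2 * c * δ) ≤ 1 * (1 - 2 * c ^ 2 + 2 * c * δ) := by
    gcongr
  have h6 : c * δ ≤ δ := by nlinarith
  have h7 : c ^ 2 * δ ≤ δ / 2 := by nlinarith
  have h8 : c ^ 2 * δ ^ 2 ≤ δ := by nlinarith
  nlinarith

lemma volume_capCone_le {E : Type*} [NormedAddCommGroup E] [InnerProductSpace ℝ E]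
    [MeasurableSpace E] [BorelSpace E] [FiniteDimensional ℝ E]
    {w : E} {c δ ρ : ℝ} (hc : 0 ≤ c) (hc' : 2 * c ^ 2 ≤ 1) (hδ : 0 ≤ δ) (hδ' : δ ≤ 1)
    (hρ : 0 ≤ ρ) (hw : ‖w‖ ≤ 1 + δ) (hcρ : 1 - c ^ 2 + 5 * δ ≤ ρ ^ 2) :
    MeasureTheory.volume (capCone w (c - δ)) ≤
      ENNReal.ofReal (ρ ^ Module.finrank ℝ E) * MeasureTheory.volume (Metric.ball (0 : E) 1) :=
  (MeasureTheory.measure_mono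
    (capCone_subset_closedBall hc hc' hδ hδ' hρ hw hcρ)).trans_eq
    (MeasureTheory.Measure.addHaar_closedBall _ _ hρ)

/-- If `w` is within `δ` of `u`, the cap of `u` lies in the enlarged cap of `w`. -/
lemma sub_mul_norm_le_inner {E : Type*} [NormedAddCommGroup E] [InnerProductSpace ℝ E]
    {x u w : E} {c δ : ℝ} (hw : ‖u - w‖ ≤ δ) (h : c * ‖x‖ ≤ inner ℝ x u) :
    (c - δ) * ‖x‖ ≤ inner ℝ x w := by
  have h1 : inner ℝ x (u - w) ≤ ‖x‖ * ‖u - w‖ := real_inner_le_norm _ _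
  have h2 : ‖x‖ * ‖u - w‖ ≤ ‖x‖ * δ := by gcongr
  rw [inner_sub_right] at h1
  linarith

/-! ### A net of directions -/

/-- A grid of mesh `1 / (4 n²)` is a `1 / (4 n)`-net of the unit sphere of `ℝⁿ`. -/
lemma exists_finset_net (n : ℕ) (hn : 1 ≤ n) :
    ∃ G : Finset (EuclideanSpace ℝ (Fin n)), G.card ≤ (8 * n ^ 2 + 1) ^ n ∧
      ∀ u : EuclideanSpace ℝ (Fin n), ‖u‖ = 1 → ∃ w ∈ G, ‖u - w‖ ≤ 1 / (4 * n) := by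
  classical
  have hn' : (1 : ℝ) ≤ n := by exact_mod_cast hn
  let f : (Fin n → ℤ) → EuclideanSpace ℝ (Fin n) :=
    fun z => WithLp.toLp 2 fun i => (z i : ℝ) / (4 * n ^ 2)
  refine ⟨(Fintype.piFinset fun _ : Fin n => Finset.Icc (-(4 * n ^ 2 : ℤ)) (4 * n ^ 2)).image f,
    ?_, fun u hu => ?_⟩
  · refine Finset.card_image_le.trans_eq ?_
    rw [Fintype.card_piFinset_const, Int.card_Icc]
    congr 1
    have : ((4 : ℤ) * n ^ 2 + 1 - -(4 * n ^ 2)) = ((8 * n ^ 2 + 1 : ℕ) : ℤ) := by push_cast; ring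
    rw [this, Int.toNat_natCast]
  · have hui : ∀ i, |u i| ≤ 1 := fun i => hu ▸ PiLp.norm_apply_le u i
    refine ⟨f fun i => ⌊u i * (4 * n ^ 2)⌋, Finset.mem_image_of_mem _ ?_, ?_⟩
    · rw [Fintype.mem_piFinset]
      intro i
      have := abs_le.1 (hui i)
      have h4 : (0 : ℝ) < 4 * n ^ 2 := by positivity
      rw [Finset.mem_Icc]
      constructor
      · rw [Int.le_floor]
        push_cast
        nlinarith
      · rw [← Int.cast_le (R := ℝ)]
        refine (Int.floor_le _).trans ?_
        push_cast
        nlinarith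
    · rw [EuclideanSpace.norm_eq, Real.sqrt_le_left (by positivity)]
      have hi : ∀ i, ‖(u - f fun i => ⌊u i * (4 * n ^ 2)⌋) i‖ ^ 2 ≤ (1 / (4 * n ^ 2 : ℝ)) ^ 2 := by
        intro i
        gcongr
        have h4 : (0 : ℝ) < 4 * n ^ 2 := by positivity
        have e : (u - f fun i => ⌊u i * (4 * n ^ 2)⌋) i =
            Int.fract (u i * (4 * n ^ 2)) / (4 * n ^ 2) := by
          simp only [PiLp.sub_apply, f, Int.fract]
          field_simp
        rw [e, Real.norm_of_nonneg (div_nonneg (Int.fract_nonneg _) h4.le)]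
        gcongr
        exact (Int.fract_lt_one _).le
      refine (Finset.sum_le_sum fun i _ => hi i).trans ?_
      rw [Finset.sum_const, Finset.card_univ, Fintype.card_fin, nsmul_eq_mul, div_pow, div_pow,
        one_pow, mul_one_div, div_le_div_iff₀ (by positivity) (by positivity)]
      have : (n : ℝ) ^ 3 ≤ n ^ 4 := pow_le_pow_right₀ hn' (by norm_num)
      nlinarith

/-! ### The greedy choice of the tips -/

/-- Averaging: if an exceptional set `S` takes up at most half of `B` and each `A i` at most a
quarter, then some point of `B \ S` lies in at most half of the sets `A i`. -/
lemma exists_mem_diff_two_mul_card_filter_le {α ι : Type*} [MeasurableSpace α]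
    (μ : MeasureTheory.Measure α) {B S : Set α} (hB : MeasurableSet B) (hS : MeasurableSet S)
    (hB₀ : μ B ≠ 0) (hB₁ : μ B ≠ ⊤) (hSB : 2 * μ S ≤ μ B) (T : Finset ι) (A : ι → Set α)
    [∀ x, DecidablePred fun i => x ∈ A i]
    (hA : ∀ i ∈ T, MeasurableSet (A i)) (hAB : ∀ i ∈ T, 4 * μ (A i) ≤ μ B) :
    ∃ x ∈ B \ S, 2 * (T.filter fun i => x ∈ A i).card ≤ T.card := by
  by_contra! hcon
  have hdiff : μ B ≤ 2 * μ (B \ S) := by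
    have h1 : μ B ≤ μ (B \ S) + μ S := by
      rw [← MeasureTheory.measure_sdiff_add_inter B hS]
      gcongr
      exact Set.inter_subset_right
    have h2 : 2 * μ B ≤ 2 * μ (B \ S) + μ B :=
      (mul_le_mul_right h1 2).trans (by rw [mul_add]; gcongr)
    rw [two_mul (μ B)] at h2
    exact (ENNReal.add_le_add_iff_right hB₁).1 h2
  have hlow : ((T.card : ENNReal) + 1) * μ (B \ S) ≤
      ∫⁻ x in B \ S, ∑ i ∈ T, (A i).indicator (fun _ => 2) x ∂μ := by
    rw [← MeasureTheory.setLIntegral_const]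
    refine MeasureTheory.setLIntegral_mono' (hB.diff hS) fun x hx => ?_
    have e : ∑ i ∈ T, (A i).indicator (fun _ => (2 : ENNReal)) x =
        ((2 * (T.filter fun i => x ∈ A i).card : ℕ) : ENNReal) := by
      simp only [Set.indicator_apply, ← Finset.sum_filter, Finset.sum_const, nsmul_eq_mul]
      push_cast
      ring
    rw [e]
    exact_mod_cast hcon x hx
  have hup : ∫⁻ x in B \ S, ∑ i ∈ T, (A i).indicator (fun _ => 2) x ∂μ ≤
      ∑ i ∈ T, 2 * μ (A i) := by
    refine (MeasureTheory.setLIntegral_le_lintegral _ _).trans_eq ?_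
    rw [MeasureTheory.lintegral_finsetSum _ fun i hi => measurable_const.indicator (hA i hi)]
    exact Finset.sum_congr rfl fun i hi => MeasureTheory.lintegral_indicator_const (hA i hi) _
  have hle : ((T.card : ENNReal) + 1) * μ B ≤ T.card * μ B :=
    calc ((T.card : ENNReal) + 1) * μ B
        ≤ ((T.card : ENNReal) + 1) * (2 * μ (B \ S)) := by gcongr
      _ = 2 * (((T.card : ENNReal) + 1) * μ (B \ S)) := by ring
      _ ≤ 2 * ∑ i ∈ T, 2 * μ (A i) := by gcongr; exact hlow.trans hup
      _ = ∑ i ∈ T, 4 * μ (A i) := by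
          rw [Finset.mul_sum]
          exact Finset.sum_congr rfl fun i _ => by ring
      _ ≤ ∑ _i ∈ T, μ B := Finset.sum_le_sum hAB
      _ = T.card * μ B := by rw [Finset.sum_const, nsmul_eq_mul]
  have := (ENNReal.mul_le_mul_iff_left hB₀ hB₁).1 hle
  exact absurd this (not_le.2 (ENNReal.lt_add_right (by simp) (by simp)))

lemma mem_capCone_iff_normalize {E : Type*} [NormedAddCommGroup E] [InnerProductSpace ℝ E]
    {x w : E} {a : ℝ} (hx₀ : x ≠ 0) (hx : x ∈ Metric.ball (0 : E) 1) :
    x ∈ capCone w a ↔ a ≤ inner ℝ (‖x‖⁻¹ • x) w := by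
  rw [capCone, Set.mem_inter_iff, and_iff_left hx, real_inner_smul_left, inv_mul_eq_div,
    le_div_iff₀ (norm_pos_iff.2 hx₀)]
  rfl

/-- Greedy choice of tips. Each `W` in the finite family `𝒲` is a tuple of cap centres whose
caps together occupy at most a quarter of the sphere. As long as the neighbourhoods of the tips
already chosen occupy at most half of the sphere, one more tip can be chosen, away from the
previous ones, that halves the number of `W` whose caps contain all tips. -/
lemma exists_separated_finset_two_pow_mul_card_le {E : Type*} [NormedAddCommGroup E]
    [InnerProductSpace ℝ E] [MeasurableSpace E] [BorelSpace E] [FiniteDimensional ℝ E]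
    [Nontrivial E] {m : ℕ} (𝒲 : Finset (Fin m → E)) (a : ℝ)
    (h𝒲 : ∀ W ∈ 𝒲, 4 * MeasureTheory.volume (⋃ j, capCone (W j) a) ≤
      MeasureTheory.volume (Metric.ball (0 : E) 1))
    (k : ℕ) (hk : 4 * (k : ℝ) * (4 / 5) ^ Module.finrank ℝ E ≤ 1) :
    ∃ P : Finset E, P.card ≤ k ∧ (∀ p ∈ P, ‖p‖ = 1) ∧
      (∀ p ∈ P, ∀ q ∈ P, p ≠ q → |inner ℝ p q| ≤ (3 / 5 : ℝ)) ∧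
      ∃ 𝒲' ⊆ 𝒲, (∀ W ∈ 𝒲, (∀ p ∈ P, ∃ j, a ≤ inner ℝ p (W j)) → W ∈ 𝒲') ∧
        2 ^ k * 𝒲'.card ≤ 𝒲.card := by
  classical
  induction k with
  | zero => exact ⟨∅, by simp, by simp, by simp, 𝒲, subset_rfl, by simp, by simp⟩
  | succ k ih =>
    have hk' : 4 * (k : ℝ) * (4 / 5) ^ Module.finrank ℝ E ≤ 1 := by
      refine le_trans ?_ hk
      gcongr
      simp
    obtain ⟨P, hPk, hP, hsep, 𝒲', h𝒲', hmem, hcard⟩ := ih hk'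
    set V := MeasureTheory.volume (Metric.ball (0 : E) 1) with hV
    let S : Set E := {0} ∪ ⋃ p ∈ P, (capCone p (3 / 5) ∪ capCone (-p) (3 / 5))
    have hSm : MeasurableSet S := (measurableSet_singleton _).union
      (P.measurableSet_biUnion fun p _ =>
        (measurableSet_capCone _ _).union (measurableSet_capCone _ _))
    have hcap : ∀ p : E, ‖p‖ = 1 → MeasureTheory.volume (capCone p (3 / 5)) ≤
        ENNReal.ofReal ((4 / 5) ^ Module.finrank ℝ E) * V := by
      intro p hp
      have := volume_capCone_le (w := p) (c := 3 / 5) (δ := 0) (ρ := 4 / 5) (by norm_num)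
        (by norm_num) le_rfl (by norm_num) (by norm_num) (by simp [hp]) (by norm_num)
      rwa [sub_zero] at this
    have hSV : 2 * MeasureTheory.volume S ≤ V := by
      have h1 : MeasureTheory.volume S ≤
          ∑ p ∈ P, 2 * (ENNReal.ofReal ((4 / 5) ^ Module.finrank ℝ E) * V) := by
        refine (MeasureTheory.measure_union_le _ _).trans ?_
        rw [MeasureTheory.measure_singleton, zero_add]
        refine (MeasureTheory.measure_biUnion_finset_le _ _).trans
          (Finset.sum_le_sum fun p hp => (MeasureTheory.measure_union_le _ _).trans ?_)
        rw [two_mul]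
        exact add_le_add (hcap p (hP p hp)) (hcap (-p) (by rw [norm_neg, hP p hp]))
      calc 2 * MeasureTheory.volume S
          ≤ 2 * (P.card * (2 * (ENNReal.ofReal ((4 / 5) ^ Module.finrank ℝ E) * V))) := by
            rw [Finset.sum_const, nsmul_eq_mul] at h1
            gcongr
        _ = 4 * P.card * ENNReal.ofReal ((4 / 5) ^ Module.finrank ℝ E) * V := by ring
        _ ≤ 4 * k * ENNReal.ofReal ((4 / 5) ^ Module.finrank ℝ E) * V := by gcongr
        _ = ENNReal.ofReal (4 * (k : ℝ) * (4 / 5) ^ Module.finrank ℝ E) * V := by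
            rw [ENNReal.ofReal_mul (by positivity), ENNReal.ofReal_mul (by norm_num),
              ENNReal.ofReal_natCast, ENNReal.ofReal_ofNat]
        _ ≤ 1 * V := by
            gcongr
            exact ENNReal.ofReal_le_one.2 hk'
        _ = V := one_mul V
    obtain ⟨x, ⟨hxB, hxS⟩, hx⟩ := exists_mem_diff_two_mul_card_filter_le
      MeasureTheory.volume (measurableSet_ball (x := (0 : E)) (ε := 1)) hSm
      (Metric.measure_ball_pos _ _ one_pos).ne' MeasureTheory.measure_ball_lt_top.ne hSV 𝒲'
      (fun W => ⋃ j, capCone (W j) a)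
      (fun W _ => MeasurableSet.iUnion fun j => measurableSet_capCone _ _)
      (fun W hW => h𝒲 W (h𝒲' hW))
    have hx₀ : x ≠ 0 := fun h => hxS (Or.inl h)
    have hy : ‖‖x‖⁻¹ • x‖ = 1 := norm_smul_inv_norm (𝕜 := ℝ) hx₀
    have hyP : ∀ p ∈ P, |inner ℝ (‖x‖⁻¹ • x) p| ≤ (3 / 5 : ℝ) := by
      intro p hp
      by_contra! h
      refine hxS (Or.inr (Set.mem_iUnion₂.2 ⟨p, hp, ?_⟩))
      rcases lt_abs.1 h with h | h
      · exact Or.inl ((mem_capCone_iff_normalize hx₀ hxB).2 h.le)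
      · exact Or.inr ((mem_capCone_iff_normalize hx₀ hxB).2 (by rw [inner_neg_right]; exact h.le))
    refine ⟨insert (‖x‖⁻¹ • x) P, (Finset.card_insert_le _ _).trans (by gcongr), ?_, ?_,
      𝒲'.filter fun W => x ∈ ⋃ j, capCone (W j) a, (Finset.filter_subset _ _).trans h𝒲', ?_, ?_⟩
    · intro p hp
      rcases Finset.mem_insert.1 hp with rfl | hp
      exacts [hy, hP p hp]
    · intro p hp q hq hpq
      rcases Finset.mem_insert.1 hp with rfl | hp <;> rcases Finset.mem_insert.1 hq with rfl | hq
      · exact absurd rfl hpq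
      · exact hyP q hq
      · rw [real_inner_comm]
        exact hyP p hp
      · exact hsep p hp q hq hpq
    · intro W hW h
      refine Finset.mem_filter.2
        ⟨hmem W hW fun p hp => h p (Finset.mem_insert_of_mem hp), ?_⟩
      obtain ⟨j, hj⟩ := h _ (Finset.mem_insert_self _ _)
      exact Set.mem_iUnion.2 ⟨j, (mem_capCone_iff_normalize hx₀ hxB).2 hj⟩
    · rw [pow_succ, mul_assoc]
      exact (Nat.mul_le_mul_left _ hx).trans hcard

lemma exists_fin_range_eq {α : Type*} {U : Finset α} (hU : U.Nonempty) {m : ℕ}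
    (h : U.card ≤ m) : ∃ f : Fin m → α, Set.range f = U := by
  have : Nonempty U := hU.to_subtype
  obtain ⟨g⟩ := Function.Embedding.nonempty_of_card_le (α := U) (β := Fin m) (by simpa using h)
  let f : Fin m → U := Function.invFun g
  have hf : Function.Surjective f := Function.invFun_surjective g.injective
  refine ⟨Subtype.val ∘ f, ?_⟩
  rw [hf.range_comp, Subtype.range_coe]

/-- There are well separated tips on the sphere that no `m` caps of angular radius `arccos c`
contain. The caps are replaced by slightly larger ones centred at a net of at most
`(8 n² + 1) ^ n ≤ 2 ^ ((2 n + 4) n)` points, so that after `(2 n + 4) n m + 1` greedy steps no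
`m`-tuple of centres is left. -/
lemma exists_separated_tips {n m : ℕ} (hn : 1 ≤ n) {c ρ : ℝ} (hc : 0 ≤ c) (hc' : 2 * c ^ 2 ≤ 1)
    (hρ : 0 ≤ ρ) (hcρ : 1 - c ^ 2 + 5 * (1 / (4 * n)) ≤ ρ ^ 2) (hm : 4 * m * ρ ^ n ≤ 1)
    (hN : 4 * (((2 * n + 4) * n * m + 1 : ℕ) : ℝ) * (4 / 5) ^ n ≤ 1) :
    ∃ P : Set (EuclideanSpace ℝ (Fin n)), (∀ p ∈ P, ‖p‖ = 1) ∧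
      (∀ p ∈ P, ∀ q ∈ P, p ≠ q → |inner ℝ p q| ≤ (3 / 5 : ℝ)) ∧
      ∀ U : Finset (EuclideanSpace ℝ (Fin n)), (∀ u ∈ U, ‖u‖ = 1) → U.Nonempty → U.card ≤ m →
        ∃ p ∈ P, ∀ u ∈ U, inner ℝ p u < c := by
  classical
  have : Nonempty (Fin n) := ⟨⟨0, hn⟩⟩
  have hn' : (1 : ℝ) ≤ n := by exact_mod_cast hn
  set δ : ℝ := 1 / (4 * n) with hδ
  have hδ₀ : 0 ≤ δ := by positivity
  have hδ₁ : δ ≤ 1 := by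
    rw [hδ, div_le_one (by positivity)]
    linarith
  obtain ⟨G, hG, hnet⟩ := exists_finset_net n hn
  let G' := G.filter fun w => ‖w‖ ≤ 1 + δ
  have hvol : ∀ W ∈ Fintype.piFinset fun _ : Fin m => G',
      4 * MeasureTheory.volume (⋃ j, capCone (W j) (c - δ)) ≤
        MeasureTheory.volume (Metric.ball (0 : EuclideanSpace ℝ (Fin n)) 1) := by
    intro W hW
    set V := MeasureTheory.volume (Metric.ball (0 : EuclideanSpace ℝ (Fin n)) 1)
    have h1 : MeasureTheory.volume (⋃ j, capCone (W j) (c - δ)) ≤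
        ∑ _j : Fin m, ENNReal.ofReal (ρ ^ n) * V := by
      refine (MeasureTheory.measure_iUnion_fintype_le _ _).trans
        (Finset.sum_le_sum fun j _ => ?_)
      have := volume_capCone_le (w := W j) hc hc' hδ₀ hδ₁ hρ
        (Finset.mem_filter.1 (Fintype.mem_piFinset.1 hW j)).2 hcρ
      rwa [finrank_euclideanSpace_fin] at this
    rw [Finset.sum_const, Finset.card_univ, Fintype.card_fin, nsmul_eq_mul] at h1
    calc 4 * MeasureTheory.volume (⋃ j, capCone (W j) (c - δ))
        ≤ 4 * (m * (ENNReal.ofReal (ρ ^ n) * V)) := by gcongr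
      _ = 4 * m * ENNReal.ofReal (ρ ^ n) * V := by ring
      _ = ENNReal.ofReal (4 * m * ρ ^ n) * V := by
          rw [ENNReal.ofReal_mul (by positivity), ENNReal.ofReal_mul (by norm_num),
            ENNReal.ofReal_natCast, ENNReal.ofReal_ofNat]
      _ ≤ 1 * V := by
          gcongr
          exact ENNReal.ofReal_le_one.2 hm
      _ = V := one_mul V
  obtain ⟨P, -, hP, hsep, 𝒲', -, hmem, hcard⟩ := exists_separated_finset_two_pow_mul_card_le
    (Fintype.piFinset fun _ : Fin m => G') (c - δ) hvol ((2 * n + 4) * n * m + 1)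
    (by rwa [finrank_euclideanSpace_fin])
  refine ⟨P, hP, hsep, fun U hU hUne hUm => ?_⟩
  -- The greedy choice has exhausted all tuples.
  have hempty : 𝒲' = ∅ := by
    by_contra hne
    have h1 : 1 ≤ 𝒲'.card := Finset.card_pos.2 (Finset.nonempty_iff_ne_empty.2 hne)
    have h2 : (Fintype.piFinset fun _ : Fin m => G').card ≤ 2 ^ ((2 * n + 4) * n * m) := by
      rw [Fintype.card_piFinset_const, pow_mul, pow_mul]
      refine Nat.pow_le_pow_left (((Finset.card_filter_le _ _).trans hG).trans
        (Nat.pow_le_pow_left ?_ _)) _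
      have h3 : n ^ 2 ≤ (2 ^ n) ^ 2 := Nat.pow_le_pow_left Nat.lt_two_pow_self.le 2
      have h4 : 1 ≤ (2 ^ n) ^ 2 := Nat.one_le_pow _ _ (by positivity)
      rw [pow_add, mul_comm 2 n, pow_mul]
      omega
    have h5 : 2 ^ ((2 * n + 4) * n * m + 1) ≤ 2 ^ ((2 * n + 4) * n * m) :=
      (Nat.le_mul_of_pos_right _ h1).trans (hcard.trans h2)
    exact absurd h5 (not_le.2 (Nat.pow_lt_pow_right (by norm_num) (Nat.lt_succ_self _)))
  by_contra! hcov
  obtain ⟨f, hf⟩ := exists_fin_range_eq hUne hUm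
  have hfU : ∀ j, f j ∈ U := fun j => by
    have : f j ∈ (U : Set _) := hf ▸ Set.mem_range_self j
    exact this
  choose W hWG hW using fun j => hnet (f j) (hU _ (hfU j))
  have hW𝒲 : W ∈ Fintype.piFinset fun _ : Fin m => G' := by
    refine Fintype.mem_piFinset.2 fun j => Finset.mem_filter.2 ⟨hWG j, ?_⟩
    have := norm_sub_norm_le (W j) (f j)
    rw [norm_sub_rev, hU _ (hfU j)] at this
    linarith [hW j]
  have hWe : W ∈ 𝒲' := by
    refine hmem W hW𝒲 fun p hp => ?_
    obtain ⟨u, hu, hpu⟩ := hcov p hp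
    obtain ⟨j, rfl⟩ : u ∈ Set.range f := hf ▸ hu
    refine ⟨j, ?_⟩
    have := sub_mul_norm_le_inner (x := p) (c := c) (hW j) (by rwa [hP p hp, mul_one])
    rwa [hP p hp, mul_one] at this
  simp [hempty] at hWe

/-! ### Asymptotics and conclusion -/

/-- The requirement on the number of greedy steps holds in high dimension because
`4 / 5 * D < 1`. -/
lemma eventually_greedy_steps_mul_le_one {D : ℝ} (hD₁ : 1 < D) (hD₂ : D < 1.116) :
    ∀ᶠ n : ℕ in Filter.atTop, ∀ m : ℕ, (m : ℝ) ≤ 0.05 * D ^ n →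
      4 * (((2 * n + 4) * n * m + 1 : ℕ) : ℝ) * (4 / 5) ^ n ≤ 1 := by
  have hx : |4 / 5 * D| < 1 := by
    rw [abs_of_pos (by linarith)]
    linarith
  have ht := tendsto_pow_const_mul_const_pow_of_abs_lt_one 2 hx
  filter_upwards [ht.eventually (ge_mem_nhds (show (0 : ℝ) < 1 / 6 by norm_num)),
    Filter.eventually_ge_atTop 1] with n h1 hn m hm
  have hn' : (1 : ℝ) ≤ n := by exact_mod_cast hn
  have h2 : (4 / 5 : ℝ) ^ n ≤ (4 / 5 * D) ^ n := by
    gcongr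
    linarith
  have h3 : (m : ℝ) * (4 / 5) ^ n ≤ 0.05 * (4 / 5 * D) ^ n := by
    rw [mul_pow, mul_left_comm, mul_comm ((4 / 5 : ℝ) ^ n)]
    gcongr
  have h4 : 0 ≤ (4 / 5 * D) ^ n := by positivity
  push_cast
  calc 4 * ((2 * (n : ℝ) + 4) * n * m + 1) * (4 / 5) ^ n
      = 4 * (2 * n + 4) * n * (m * (4 / 5) ^ n) + 4 * (4 / 5) ^ n := by ring
    _ ≤ 4 * (2 * n + 4) * n * (0.05 * (4 / 5 * D) ^ n) + 4 * (4 / 5 * D) ^ n := by gcongr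
    _ = (0.4 * n ^ 2 + 0.8 * n + 4) * (4 / 5 * D) ^ n := by ring
    _ ≤ (6 * n ^ 2) * (4 / 5 * D) ^ n := by
        gcongr
        nlinarith
    _ ≤ 1 := by linarith

/-- The caps lost to the net enlarge the radius `1 / D` by the factor `1 + 1 / n`, which costs a
factor of at most `e` in volume. -/
lemma four_mul_mul_cap_radius_pow_le_one {D : ℝ} (hD : 0 < D) {n m : ℕ} (hn : 1 ≤ n)
    (hm : (m : ℝ) ≤ 0.05 * D ^ n) : 4 * m * (1 / D * (1 + 1 / n)) ^ n ≤ 1 := by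
  have hn' : (1 : ℝ) ≤ n := by exact_mod_cast hn
  have h1 : (1 + 1 / (n : ℝ)) ^ n ≤ 3 := by
    calc (1 + 1 / (n : ℝ)) ^ n ≤ Real.exp (1 / n) ^ n := by
          gcongr
          linarith [Real.add_one_le_exp (1 / (n : ℝ))]
      _ = Real.exp 1 := by rw [← Real.exp_nat_mul, mul_one_div_cancel (by positivity)]
      _ ≤ 3 := by linarith [Real.exp_one_lt_d9]
  calc 4 * m * (1 / D * (1 + 1 / n)) ^ n
      ≤ 4 * (0.05 * D ^ n) * ((1 / D) ^ n * 3) := by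
        rw [mul_pow]
        gcongr
    _ = 0.6 * (D * (1 / D)) ^ n := by rw [mul_pow]; ring
    _ ≤ 1 := by
        rw [mul_one_div_cancel hD.ne', one_pow]
        norm_num

theorem theorem1 (D : ℝ) (hD₁ : 1 < D) (hD₂ : D < 1.116) :
    ∃ n₀ : ℕ, ∀ n : ℕ, n₀ ≤ n →
      ∃ K : Set (EuclideanSpace ℝ (Fin n)),
        IsConvexBody K ∧ -K = K ∧
        Metric.closedBall (0 : EuclideanSpace ℝ (Fin n)) (1 / D) ⊆ K ∧
        K ⊆ Metric.closedBall (0 : EuclideanSpace ℝ (Fin n)) 1 ∧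
        ∃ m : ℕ, illuminationNumber K = (m : ℕ∞) ∧
          coveringNumber K (interior K) = (m : ℕ∞) ∧
          0.05 * D ^ n ≤ (m : ℝ) := by
  have hD₀ : 0 < D := by linarith
  obtain ⟨n₀, hn₀⟩ := Filter.eventually_atTop.1
    ((eventually_greedy_steps_mul_le_one hD₁ hD₂).and (Filter.eventually_ge_atTop 1))
  refine ⟨n₀, fun n hn => ?_⟩
  obtain ⟨hN, hn1⟩ := hn₀ n hn
  have hn' : (1 : ℝ) ≤ n := by exact_mod_cast hn1
  have : Nonempty (Fin n) := ⟨⟨0, hn1⟩⟩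
  have hr₀ : 0 < 1 / D := by positivity
  have hr₁ : 1 / D ≤ 1 := by
    rw [div_le_one hD₀]
    exact hD₁.le
  have hD2 : D ^ 2 ≤ 1.25 := by nlinarith
  -- `0.8 ≤ 1 / D²` gives both `3 / 5 ≤ 2 / D² - 1` and the room needed for the net.
  have hr2 : 0.8 ≤ (1 / D) ^ 2 := by
    rw [div_pow, one_pow, le_div_iff₀ (by positivity)]
    linarith
  have hr2' : (1 / D) ^ 2 ≤ 1 := pow_le_one₀ hr₀.le hr₁
  set m := ⌊0.05 * D ^ n⌋₊ with hm
  have hmle : (m : ℝ) ≤ 0.05 * D ^ n := Nat.floor_le (by positivity)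
  have hc2 : √(1 - (1 / D) ^ 2) ^ 2 = 1 - (1 / D) ^ 2 := Real.sq_sqrt (by linarith)
  obtain ⟨P, hP, hsep, hPU⟩ := exists_separated_tips (n := n) (m := m)
    (c := √(1 - (1 / D) ^ 2)) (ρ := 1 / D * (1 + 1 / n)) hn1 (Real.sqrt_nonneg _)
    (by rw [hc2]; linarith) (by positivity)
    (by
      have e : 1 / (4 * (n : ℝ)) = 1 / n / 4 := by rw [div_div, mul_comm]
      have h1 : 0 < 1 / (n : ℝ) := by positivity
      rw [hc2, e, mul_pow]
      nlinarith [mul_le_mul_of_nonneg_right hr2 h1.le, sq_nonneg (1 / D * (1 / n))])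
    (four_mul_mul_cap_radius_pow_le_one hD₀ hn1 hmle) (hN m hmle)
  have hsep' : ∀ p ∈ P, ∀ q ∈ P, p ≠ q → |inner ℝ p q| ≤ 2 * (1 / D) ^ 2 - 1 :=
    fun p hp q hq hpq => (hsep p hp q hq hpq).trans (by linarith)
  have hK := isConvexBody_spikyBall hP hr₀ hr₁
  have heq : illuminationNumber (spikyBall P (1 / D)) =
      coveringNumber (spikyBall P (1 / D)) (interior (spikyBall P (1 / D))) :=
    (illuminationNumber_le_coveringNumber hK).antisymm (coveringNumber_le_illuminationNumber hK)
  obtain ⟨k, hk⟩ := ENat.ne_top_iff_exists.1 (coveringNumber_interior_ne_top hK)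
  refine ⟨spikyBall P (1 / D), hK, neg_spikyBall, closedBall_subset_spikyBall,
    spikyBall_subset_closedBall hP hr₁, k, heq.trans hk.symm, hk.symm, ?_⟩
  have hlow : ((m + 1 : ℕ) : ℕ∞) ≤ illuminationNumber (spikyBall P (1 / D)) := by
    refine le_iInf₂ fun U hU => ?_
    by_contra! hlt
    have hfin : U.Finite := Set.encard_lt_top_iff.1 (hlt.trans (ENat.natCast_lt_top _))
    obtain ⟨b, hb⟩ := frontier_nonempty_of_isConvexBody hK
    obtain ⟨u₀, hu₀, -⟩ := hU.2 b hb
    rw [hfin.encard_eq_coe_toFinset_card] at hlt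
    have hcard : hfin.toFinset.card ≤ m := Nat.lt_succ_iff.1 (by exact_mod_cast hlt)
    have hU1 : ∀ u ∈ U, ‖u‖ = 1 := fun u hu => by simpa using hU.1 hu
    classical
    obtain ⟨p, hp, hpU⟩ := hPU (hfin.toFinset.image fun u => -u)
      (by simpa using fun u hu => hU1 u hu)
      (Finset.Nonempty.image ⟨u₀, by simpa using hu₀⟩ _) (Finset.card_image_le.trans hcard)
    obtain ⟨u, hu, hup⟩ := hU.2 p (mem_frontier_spikyBall hP hr₁ hp)
    exact (hpU (-u) (Finset.mem_image_of_mem _ (by simpa using hu))).not_ge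
      (hup.le_inner_neg hP hr₀.le hr₁ hsep' hp (hU1 u hu))
  rw [heq, ← hk] at hlow
  have hlow : m + 1 ≤ k := by exact_mod_cast hlow
  calc 0.05 * D ^ n ≤ (m : ℝ) + 1 := (Nat.lt_floor_add_one _).le
    _ ≤ k := by exact_mod_cast hlow
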